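/- Let $1<\beta\le 2$, $\alpha=\beta-1$, $z_0\in(0,1)$. Write $\|f\|=\sup_{[0,1]}|f|$ and let $\mathcal H(\beta)$ be the set of $S\in C^1([0,1],\mathbb R)$ whose derivative is Hölder continuous of exponent $\alpha$. For $0<\delta<1$ let $$\mathcal U_{z_0,\delta}=\Big\{S\in\mathcal H(\beta):\ \|S'\|\le\delta^{-1},\ \Big|\int_{-1}^{1}\big(S(z_0+hu)-S(z_0)\big)du\Big|\le\delta h^{\beta}\ \text{ for all } h>0 \text{ with } [z_0-h,z_0+h]\subseteq[0,1]\Big\}.$$ One observes $y_k=S(x_k)+g(x_k,S)\xi_k$, $x_k=k/n$, $1\le k\le n$, where the $\xi_k$ are i.i.d. with an unknown density $p$ in $$\mathcal P_{\varepsilon,L}=\Big\{p:\ \int xp(x)\,dx=0,\ \int x^2p(x)\,dx=1,\ \int|x|^{2+\varepsilon}p(x)\,dx\le L\Big\};$$ here $\varepsilon>0$ and $L$ is so large that the standard Gaussian density belongs to $\mathcal P_{\varepsilon,L}$. Put $Q=\mathbf 1_{[-1,1]}$, $h_n=n^{-1/(2\beta+1)}$, $q_n=\sum_{k=1}^nQ\big(\frac{x_k-z_0}{h_n}\big)$,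 $\varphi_n=n^{\beta/(2\beta+1)}$. The function $g:[0,1]\times C^1([0,1],\mathbb R)\to(0,\infty)$ is assumed to satisfy: (a) $g_\star\le g(x,S)\le g^\star$ for all $x,S$, for some constants $0<g_\star\le g^\star<\infty$; (b) for every $0<\delta<1$, $$\lim_{n\to\infty}\sup_{S\in\mathcal U_{z_0,\delta}}\Big|\Big(\frac1{q_n}\sum_{k=1}^nQ\Big(\frac{x_k-z_0}{h_n}\Big)g^2(x_k,S)\Big)^{1/2}-g(z_0,S)\Big|=0;$$ (c) for each $S_0\in C^1([0,1],\mathbb R)$ there are linear forms $L_{x,S_0}$, $x\in[0,1]$, on $C^1([0,1],\mathbb R)$ and a constant $C_{S_0}$ such that $|L_{x,S_0}(f)|\le C_{S_0}\|f\|$ for all $x,f$, and $\sup_{x}|g(x,S_0+f)-g(x,S_0)-L_{x,S_0}(f)|/\|f\|\to0$ as $\|f\|\to0$. For an estimator $\tilde S_n$ of $S(z_0)$, that is, a function of $y_1,\dots,y_n$, let $$\tilde{\mathcal R}_{z_0,\delta}(\tilde S_n)=\sup_{p\in\mathcal P_{\varepsilon,L}}\ \sup_{S\in\mathcal U_{z_0,\delta}}\mathbb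 E\,\varphi_n\frac{|\tilde S_n-S(z_0)|}{g(z_0,S)} .$$ Then the kernel estimator $\hat S_n=\frac1{q_n}\sum_{k=1}^nQ\big(\frac{x_k-z_0}{h_n}\big)y_k$ satisfies $$\limsup_{\delta\to0}\ \limsup_{n\to\infty}\ \tilde{\mathcal R}_{z_0,\delta}(\hat S_n)\ \le\ \frac{\mathbb E|\eta|}{\sqrt2},\qquad \eta\sim\mathcal N(0,1),$$ and the constant is attained: for every $0<\delta<1$, $\liminf_{n\to\infty}\tilde{\mathcal R}_{z_0,\delta}(\hat S_n)\ge\mathbb E|\eta|/\sqrt2$. -/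

import Mathlib

open Set Filter Topology MeasureTheory ProbabilityTheory
open scoped ENNReal

noncomputable section

namespace HeteroReg

/-- The space `C¹([0,1], ℝ)` (one-sided derivatives at the end points), as a subspace of the
continuous functions on `[0,1]`. Its norm is the supremum norm `‖S‖ = sup |S|`. -/
def C1 : Submodule ℝ C(unitInterval, ℝ) where
  carrier := {f | ContDiffOn ℝ 1 (Set.IccExtend (zero_le_one' ℝ) f) (Set.Icc 0 1)}
  add_mem' := fun {_ _} hf hg => ContDiffOn.add hf hg
  zero_mem' := contDiffOn_const (c := (0 : ℝ))
  smul_mem' := fun c _ hf => ContDiffOn.const_smul c hf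

/-- `S` as a function of a real argument; only arguments in `[0,1]` are ever relevant. -/
def extend (S : C1) : ℝ → ℝ := Set.IccExtend (zero_le_one' ℝ) S.1

/-- The value `S(x)`, `x ∈ [0,1]`. -/
def value (S : C1) (x : unitInterval) : ℝ := S.1 x

/-- The derivative `S'(x)`, `x ∈ [0,1]` (one-sided at the end points). -/
def slope (S : C1) (x : unitInterval) : ℝ :=
  derivWithin (extend S) (Set.Icc 0 1) x

/-- The Hölder class `H(M, K, β)`, with `α = β - 1`. -/
def holderBall (M K β : ℝ) : Set C1 :=
  {S | (∀ x, |slope S x| ≤ M) ∧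
    ∀ x y : unitInterval, |slope S y - slope S x| ≤ K * |(x : ℝ) - y| ^ (β - 1)}

/-- `H(β)`, the union of the classes `H(M, K, β)` over `M > 0`, `K > 0`. -/
def holderClass (β : ℝ) : Set C1 :=
  ⋃ (M : ℝ) (_ : 0 < M) (K : ℝ) (_ : 0 < K), holderBall M K β

/-- The local weak Hölder class at `z₀`. The integral condition is imposed for every `h > 0` for
which it makes sense, that is, such that `[z₀ - h, z₀ + h] ⊆ [0,1]`. -/
def weakHolder (β : ℝ) (z₀ : unitInterval) (δ : ℝ) : Set C1 :=
  {S | S ∈ holderClass β ∧ (∀ x, |slope S x| ≤ δ⁻¹) ∧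
    ∀ h : ℝ, 0 < h → 0 ≤ z₀ - h → z₀ + h ≤ 1 →
      |∫ u in (-1 : ℝ)..1, (extend S (z₀ + h * u) - value S z₀)| ≤ δ * h ^ β}

/-- The regressors `x_k = k / n`, `k = 1, …, n` (the index `k : Fin n` stands for `k + 1`). -/
def design (n : ℕ) (k : Fin n) : unitInterval :=
  ⟨((k : ℝ) + 1) / n, by
    have hk : ((k : ℕ) : ℝ) + 1 ≤ n := by exact_mod_cast k.2
    exact ⟨by positivity, div_le_one_of_le₀ hk (by positivity)⟩⟩

/-- The kernel `Q`, the indicator function of `[-1, 1]`. -/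
def kernel : ℝ → ℝ := Set.indicator (Set.Icc (-1) 1) fun _ => 1

/-- The bandwidth `h = n ^ (-1 / (2β + 1))`. -/
def bandwidth (β : ℝ) (n : ℕ) : ℝ := (n : ℝ) ^ (-1 / (2 * β + 1))

/-- The normalization `φ_n = n ^ (β / (2β + 1))`. -/
def rate (β : ℝ) (n : ℕ) : ℝ := (n : ℝ) ^ (β / (2 * β + 1))

/-- The kernel weight `Q((x_k - z₀) / h)`. -/
def weight (β : ℝ) (z₀ : unitInterval) (n : ℕ) (k : Fin n) : ℝ :=
  kernel (((design n k : ℝ) - z₀) / bandwidth β n)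

/-- `q_n = ∑ Q((x_k - z₀) / h)`. -/
def totalWeight (β : ℝ) (z₀ : unitInterval) (n : ℕ) : ℝ := ∑ k, weight β z₀ n k

/-- The kernel estimator of `S(z₀)`, as a function of the observations `y_1, …, y_n`. -/
def kernelEstimator (β : ℝ) (z₀ : unitInterval) (n : ℕ) (y : Fin n → ℝ) : ℝ :=
  (1 / totalWeight β z₀ n) * ∑ k, weight β z₀ n k * y k

/-- The standing assumptions on the scale functional `g : [0,1] × C¹([0,1], ℝ) → (0, ∞)`. -/
structure IsScale (β : ℝ) (z₀ : unitInterval) (g : unitInterval → C1 → ℝ) : Prop where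
  /-- `g` is bounded, and bounded away from zero. -/
  bounds : ∃ gmin gmax : ℝ, 0 < gmin ∧ ∀ x S, gmin ≤ g x S ∧ g x S ≤ gmax
  /-- For every `0 < δ < 1`, the local averages of `g²` approach `g²(z₀, S)`, in the sense that
  `sup_S |((1/q_n) ∑ Q((x_k - z₀)/h) g²(x_k, S))^(1/2) - g(z₀, S)| → 0`, the supremum being over
  the local weak Hölder class. -/
  average : ∀ δ : ℝ, 0 < δ → δ < 1 →
    TendstoUniformlyOn
      (fun (n : ℕ) (S : C1) =>
        √((1 / totalWeight β z₀ n) * ∑ k, weight β z₀ n k * g (design n k) S ^ 2))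
      (fun S => g z₀ S) atTop (weakHolder β z₀ δ)
  /-- `g` is Fréchet differentiable in `S` with respect to the supremum norm, uniformly over `x`,
  with derivatives `L x` that are bounded uniformly over `x`. -/
  frechet : ∀ S₀ : C1, ∃ L : unitInterval → C1 →ₗ[ℝ] ℝ,
    (∃ C : ℝ, 0 < C ∧ ∀ x S, |L x S| ≤ C * ‖S‖) ∧
    ∀ r : ℝ, 0 < r → ∃ η : ℝ, 0 < η ∧ ∀ f : C1, ‖f‖ ≤ η →
      ∀ x, |g x (S₀ + f) - g x S₀ - L x f| ≤ r * ‖f‖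

/-- The class of probability densities on the real line with mean `0`, variance `1` and absolute
moment of order `2 + ε` at most `L`. -/
structure IsNoiseDensity (ε L : ℝ) (p : ℝ → ℝ) : Prop where
  measurable : Measurable p
  nonneg : ∀ x, 0 ≤ p x
  integrable : Integrable p
  integral_eq_one : ∫ x, p x = 1
  integrable_mean : Integrable fun x => x * p x
  mean_eq_zero : ∫ x, x * p x = 0
  integrable_sq : Integrable fun x => x ^ 2 * p x
  sq_eq_one : ∫ x, x ^ 2 * p x = 1
  integrable_moment : Integrable fun x => |x| ^ (2 + ε) * p x
  moment_le : ∫ x, |x| ^ (2 + ε) * p x ≤ L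

/-- The distribution with density `p`. -/
def noiseLaw (p : ℝ → ℝ) : Measure ℝ := volume.withDensity fun x => ENNReal.ofReal (p x)

/-- The law of the observations `y_k = S(x_k) + g(x_k, S) ξ_k`, `k = 1, …, n`, when the `ξ_k` are
independent with density `p`. -/
def obsLaw (g : unitInterval → C1 → ℝ) (p : ℝ → ℝ) (S : C1) (n : ℕ) : Measure (Fin n → ℝ) :=
  (Measure.pi fun _ : Fin n => noiseLaw p).map
    fun ξ k => value S (design n k) + g (design n k) S * ξ k

/-- The maximal normalized absolute error risk of an estimator `T` of `S(z₀)`, over all noise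
densities in the class and all `S` in the local weak Hölder class. -/
def risk (β : ℝ) (z₀ : unitInterval) (g : unitInterval → C1 → ℝ) (ε L δ : ℝ) (n : ℕ)
    (T : (Fin n → ℝ) → ℝ) : ℝ≥0∞ :=
  ⨆ (p : ℝ → ℝ) (_ : IsNoiseDensity ε L p) (S : C1) (_ : S ∈ weakHolder β z₀ δ),
    ∫⁻ y, ENNReal.ofReal (rate β n * (|T y - value S z₀| / g z₀ S)) ∂(obsLaw g p S n)

/-- The constant `E|η| / √2`, with `η` standard Gaussian. -/
def sharpConstant : ℝ≥0∞ := ENNReal.ofReal ((∫ x, |x| ∂(gaussianReal 0 1)) / √2)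

end HeteroReg

end

/-!
Up to normalization, the error of the kernel estimator is a deterministic bias plus a linear form
`∑ aₖ ξₖ` in the noise. The bias is, up to `O(h)`, a Riemann sum of the integral in the weak Hölder
condition, so after normalization it is at most `δ / inf g` in the limit. The coefficients satisfy
`max |aₖ| → 0` and, by the averaging assumption on `g`, `∑ aₖ² → 1/2`. Lindeberg's replacement of
the noise variables by Gaussian ones, applied to the smooth function `√(x² + s²)` in place of `|x|`
and using only the moment of order `2 + ε`, then gives `E|∑ aₖ ξₖ| → E|η| / √2` uniformly in the
noise law and in `S`. For the lower bound take `S = 0`, where there is no bias.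
-/

namespace HeteroReg

open scoped NNReal

/-! ### A smooth approximation of the absolute value -/

/-- The function `√(x² + s²)`, a smooth surrogate of `|x|` within distance `s` of it. -/
noncomputable def smoothAbs (s x : ℝ) : ℝ := √(x ^ 2 + s ^ 2)

section SmoothAbs

variable {s : ℝ}

lemma smoothAbs_sq (s x : ℝ) : smoothAbs s x ^ 2 = x ^ 2 + s ^ 2 :=
  Real.sq_sqrt (by positivity)

lemma le_smoothAbs (s x : ℝ) : s ≤ smoothAbs s x :=
  Real.le_sqrt_of_sq_le (by nlinarith [sq_nonneg x])

lemma smoothAbs_pos (hs : 0 < s) (x : ℝ) : 0 < smoothAbs s x :=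
  hs.trans_le (le_smoothAbs s x)

lemma abs_le_smoothAbs (s x : ℝ) : |x| ≤ smoothAbs s x :=
  Real.abs_le_sqrt (by nlinarith [sq_nonneg s])

lemma smoothAbs_le (hs : 0 ≤ s) (x : ℝ) : smoothAbs s x ≤ |x| + s :=
  Real.sqrt_le_iff.2 ⟨by positivity, by nlinarith [abs_nonneg x, sq_abs x]⟩

lemma contDiff_smoothAbs (hs : 0 < s) {n : WithTop ℕ∞} : ContDiff ℝ n (smoothAbs s) :=
  ContDiff.sqrt (by fun_prop) fun x => by positivity

lemma hasDerivAt_smoothAbs (hs : 0 < s) (x : ℝ) :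
    HasDerivAt (smoothAbs s) (x / smoothAbs s x) x := by
  have h : HasDerivAt (fun x : ℝ => x ^ 2 + s ^ 2) (2 * x) x := by
    simpa using (hasDerivAt_pow 2 x).add_const (s ^ 2)
  have := h.sqrt (by positivity)
  rwa [mul_div_mul_left _ _ two_ne_zero] at this

lemma iteratedDeriv_two_smoothAbs (hs : 0 < s) (x : ℝ) :
    iteratedDeriv 2 (smoothAbs s) x = s ^ 2 / smoothAbs s x ^ 3 := by
  have hderiv : deriv (smoothAbs s) = fun x => x / smoothAbs s x :=
    funext fun x => (hasDerivAt_smoothAbs hs x).deriv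
  have h0 := (smoothAbs_pos hs x).ne'
  have hsq := smoothAbs_sq s x
  rw [iteratedDeriv_succ, iteratedDeriv_one, hderiv]
  refine (((hasDerivAt_id' x).fun_div (hasDerivAt_smoothAbs hs x) h0).congr_deriv ?_).deriv
  field_simp
  linarith

lemma lipschitzWith_smoothAbs (hs : 0 < s) : LipschitzWith 1 (smoothAbs s) := by
  refine lipschitzWith_of_nnnorm_deriv_le (fun x => (hasDerivAt_smoothAbs hs x).differentiableAt)
    fun x => ?_
  rw [(hasDerivAt_smoothAbs hs x).deriv, ← NNReal.coe_le_coe, coe_nnnorm, Real.norm_eq_abs, abs_div,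
    abs_of_pos (smoothAbs_pos hs x)]
  exact div_le_one_of_le₀ (abs_le_smoothAbs s x) (smoothAbs_pos hs x).le

lemma iteratedDeriv_two_smoothAbs_mem_Icc (hs : 0 < s) (x : ℝ) :
    iteratedDeriv 2 (smoothAbs s) x ∈ Icc 0 s⁻¹ := by
  have hA := smoothAbs_pos hs x
  rw [iteratedDeriv_two_smoothAbs hs]
  refine ⟨by positivity, ?_⟩
  calc s ^ 2 / smoothAbs s x ^ 3 ≤ s ^ 2 / s ^ 3 := by
        gcongr
        exact le_smoothAbs s x
    _ = s⁻¹ := by field_simp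

lemma hasDerivAt_iteratedDeriv_two_smoothAbs (hs : 0 < s) (x : ℝ) :
    HasDerivAt (iteratedDeriv 2 (smoothAbs s)) (-(3 * s ^ 2 * x) / smoothAbs s x ^ 5) x := by
  have hA := (smoothAbs_pos hs x).ne'
  rw [funext (iteratedDeriv_two_smoothAbs hs)]
  refine ((hasDerivAt_const x (s ^ 2)).fun_div ((hasDerivAt_smoothAbs hs x).fun_pow 3)
    (pow_ne_zero 3 hA)).congr_deriv ?_
  field_simp
  ring

lemma lipschitzWith_iteratedDeriv_two_smoothAbs (hs : 0 < s) :
    LipschitzWith (3 / s ^ 2).toNNReal (iteratedDeriv 2 (smoothAbs s)) := by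
  have hderiv := hasDerivAt_iteratedDeriv_two_smoothAbs hs
  refine lipschitzWith_of_nnnorm_deriv_le (fun x => (hderiv x).differentiableAt) fun x => ?_
  have hA := smoothAbs_pos hs x
  rw [(hderiv x).deriv, ← NNReal.coe_le_coe, coe_nnnorm, Real.coe_toNNReal _ (by positivity),
    Real.norm_eq_abs, abs_div, abs_neg, abs_mul, abs_of_pos (by positivity : 0 < 3 * s ^ 2),
    abs_of_pos (pow_pos hA 5)]
  calc 3 * s ^ 2 * |x| / smoothAbs s x ^ 5
      ≤ 3 * s ^ 2 * smoothAbs s x / smoothAbs s x ^ 5 := by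
        gcongr
        exact abs_le_smoothAbs s x
    _ = 3 * s ^ 2 / smoothAbs s x ^ 4 := by field_simp
    _ ≤ 3 * s ^ 2 / s ^ 4 := by
        gcongr
        exact le_smoothAbs s x
    _ = 3 / s ^ 2 := by field_simp

lemma exists_holderWith_iteratedDeriv_two_smoothAbs (hs : 0 < s) :
    ∃ D : ℝ≥0, ∀ r : ℝ≥0, r ≤ 1 → HolderWith D r (iteratedDeriv 2 (smoothAbs s)) := by
  have hbound : HolderWith s⁻¹.toNNReal 0 (iteratedDeriv 2 (smoothAbs s)) := fun x y => by
    rw [NNReal.coe_zero, ENNReal.rpow_zero, mul_one, edist_le_coe, ← NNReal.coe_le_coe,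
      coe_nndist, Real.coe_toNNReal _ (inv_nonneg.2 hs.le)]
    simpa using Real.dist_le_of_mem_Icc (iteratedDeriv_two_smoothAbs_mem_Icc hs x)
      (iteratedDeriv_two_smoothAbs_mem_Icc hs y)
  exact ⟨_, fun r hr => hbound.of_le_of_le
    (holderWith_one.2 (lipschitzWith_iteratedDeriv_two_smoothAbs hs)) zero_le hr⟩

end SmoothAbs

/-! ### Lindeberg's replacement method -/

lemma abs_sub_taylor_two_le {f : ℝ → ℝ} {D r : ℝ≥0} (hf : ContDiff ℝ 2 f)
    (hD : HolderWith D r (iteratedDeriv 2 f)) (x y : ℝ) :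
    |f (x + y) - (f x + deriv f x * y + iteratedDeriv 2 f x * y ^ 2 / 2)|
      ≤ D / 2 * |y| ^ (2 + r : ℝ) := by
  rcases eq_or_ne y 0 with rfl | hy
  · simp only [add_zero, mul_zero, ne_eq, OfNat.ofNat_ne_zero, not_false_eq_true, zero_pow,
      zero_div, sub_self, abs_zero]
    positivity
  have hne : x ≠ x + y := by simpa using hy
  obtain ⟨ξ, hξ, h⟩ := taylor_mean_remainder_lagrange_iteratedDeriv (n := 1) hne
    (hf.contDiffOn.of_le (by norm_num))
  have hderiv : derivWithin f (uIcc x (x + y)) x = deriv f x :=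
    (hf.differentiable (by norm_num) x).derivWithin (uniqueDiffOn_uIcc hne x left_mem_uIcc)
  rw [taylorWithinEval_succ, taylor_within_zero_eval, iteratedDerivWithin_one, hderiv] at h
  have hξx : |ξ - x| ≤ |y| := by
    simpa using abs_sub_left_of_mem_uIcc (Ioo_subset_Icc_self hξ)
  calc |f (x + y) - (f x + deriv f x * y + iteratedDeriv 2 f x * y ^ 2 / 2)|
      = |iteratedDeriv 2 f ξ - iteratedDeriv 2 f x| * y ^ 2 / 2 := by
        rw [← abs_of_nonneg (sq_nonneg y), ← abs_mul, ← abs_two (α := ℝ), ← abs_div]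
        congr 1
        norm_num at h ⊢
        linarith
    _ ≤ D * |y| ^ (r : ℝ) * y ^ 2 / 2 := by
        gcongr
        refine (hD.dist_le ξ x).trans ?_
        rw [Real.dist_eq]
        gcongr
    _ = D / 2 * |y| ^ (2 + r : ℝ) := by
        rw [Real.rpow_add (abs_pos.2 hy), Real.rpow_two, sq_abs]
        ring

/-- Probability measures on the line with mean `0`, variance `1` and absolute moment of order
`2 + r` at most `M`: the laws of the summands in Lindeberg's method. -/
structure IsStandardized (r M : ℝ) (μ : Measure ℝ) : Prop where
  isProbabilityMeasure : IsProbabilityMeasure μ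
  integrable : Integrable (fun x => x) μ
  mean : ∫ x, x ∂μ = 0
  integrable_sq : Integrable (fun x => x ^ 2) μ
  sq : ∫ x, x ^ 2 ∂μ = 1
  integrable_moment : Integrable (fun x => |x| ^ (2 + r)) μ
  moment_le : ∫ x, |x| ^ (2 + r) ∂μ ≤ M

lemma IsStandardized.mono {r r' M : ℝ} {μ : Measure ℝ} (h : IsStandardized r M μ) (hr' : 0 ≤ r')
    (hrr : r' ≤ r) : IsStandardized r' (1 + M) μ := by
  have := h.isProbabilityMeasure
  have hle (x : ℝ) : |x| ^ (2 + r') ≤ 1 + |x| ^ (2 + r) := by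
    rcases le_total |x| 1 with hx | hx
    · have h1 := Real.rpow_le_one (abs_nonneg x) hx (by linarith : 0 ≤ 2 + r')
      have h2 := Real.rpow_nonneg (abs_nonneg x) (2 + r)
      linarith
    · have := Real.rpow_le_rpow_of_exponent_le hx (by linarith : 2 + r' ≤ 2 + r)
      linarith
  have hdom : Integrable (fun x : ℝ => 1 + |x| ^ (2 + r)) μ :=
    (integrable_const 1).add h.integrable_moment
  have hint : Integrable (fun x : ℝ => |x| ^ (2 + r')) μ :=
    integrable_norm_rpow_of_le (f := id) aestronglyMeasurable_id (by linarith) (by linarith)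
      (by linarith) h.integrable_moment
  refine ⟨h.isProbabilityMeasure, h.integrable, h.mean, h.integrable_sq, h.sq, hint, ?_⟩
  calc ∫ x, |x| ^ (2 + r') ∂μ ≤ ∫ x, (1 + |x| ^ (2 + r)) ∂μ := integral_mono hint hdom hle
    _ = 1 + ∫ x, |x| ^ (2 + r) ∂μ := by
      rw [integral_add (integrable_const 1) h.integrable_moment]
      simp
    _ ≤ 1 + M := by linarith [h.moment_le]

lemma integrable_comp_of_lipschitzWith {Ω E F : Type*} [MeasurableSpace Ω] {P : Measure Ω}
    [IsFiniteMeasure P] [NormedAddCommGroup E] [NormedAddCommGroup F] {K : ℝ≥0} {f : E → F}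
    (hf : LipschitzWith K f) {X : Ω → E} (hX : Integrable X P) :
    Integrable (fun ω => f (X ω)) P := by
  refine ((integrable_const ‖f 0‖).add (hX.norm.const_mul K)).mono'
    (hf.continuous.comp_aestronglyMeasurable hX.1) (ae_of_all _ fun ω => ?_)
  have hlip := hf.dist_le_mul (X ω) 0
  rw [dist_eq_norm, dist_zero_right] at hlip
  calc ‖f (X ω)‖ ≤ ‖f 0‖ + ‖f (X ω) - f 0‖ := norm_le_norm_add_norm_sub' _ _
    _ ≤ ‖f 0‖ + K * ‖X ω‖ := by gcongr

lemma IsStandardized.abs_integral_sub_taylor_le {f : ℝ → ℝ} {D K r : ℝ≥0} {M : ℝ} {μ : Measure ℝ}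
    (hμ : IsStandardized r M μ) (hf : ContDiff ℝ 2 f) (hK : LipschitzWith K f)
    (hD : HolderWith D r (iteratedDeriv 2 f)) (x a : ℝ) :
    |∫ y, f (x + a * y) ∂μ - (f x + iteratedDeriv 2 f x * a ^ 2 / 2)|
      ≤ D / 2 * M * |a| ^ (2 + r : ℝ) := by
  have := hμ.isProbabilityMeasure
  let taylor (y : ℝ) : ℝ := f x + deriv f x * (a * y) + iteratedDeriv 2 f x * (a * y) ^ 2 / 2
  have hf_int : Integrable (fun y => f (x + a * y)) μ :=
    integrable_comp_of_lipschitzWith hK ((integrable_const x).add (hμ.integrable.const_mul a))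
  have hlin_int : Integrable (fun y => f x + deriv f x * a * y) μ :=
    (integrable_const _).add (hμ.integrable.const_mul _)
  have hsq_int := hμ.integrable_sq.const_mul (iteratedDeriv 2 f x * a ^ 2 / 2)
  have htaylor : taylor = fun y =>
      f x + deriv f x * a * y + iteratedDeriv 2 f x * a ^ 2 / 2 * y ^ 2 := by
    ext y
    ring
  have htaylor_int : Integrable taylor μ := htaylor ▸ hlin_int.add hsq_int
  have htaylor_eq : ∫ y, taylor y ∂μ = f x + iteratedDeriv 2 f x * a ^ 2 / 2 := by
    rw [htaylor, integral_add hlin_int hsq_int,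
      integral_add (integrable_const _) (hμ.integrable.const_mul _), integral_const_mul,
      integral_const_mul, hμ.mean, hμ.sq]
    simp
  rw [← htaylor_eq, ← integral_sub hf_int htaylor_int, ← Real.norm_eq_abs]
  calc ‖∫ y, (f (x + a * y) - taylor y) ∂μ‖
      ≤ ∫ y, D / 2 * |a| ^ (2 + r : ℝ) * |y| ^ (2 + r : ℝ) ∂μ := by
        refine norm_integral_le_of_norm_le (hμ.integrable_moment.const_mul _)
          (ae_of_all _ fun y => (abs_sub_taylor_two_le hf hD x (a * y)).trans_eq ?_)
        rw [abs_mul, Real.mul_rpow (abs_nonneg _) (abs_nonneg _), mul_assoc]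
    _ = D / 2 * |a| ^ (2 + r : ℝ) * ∫ y, |y| ^ (2 + r : ℝ) ∂μ := integral_const_mul _ _
    _ ≤ D / 2 * |a| ^ (2 + r : ℝ) * M := by
        gcongr
        exact hμ.moment_le
    _ = D / 2 * M * |a| ^ (2 + r : ℝ) := by ring

lemma integral_pi_fin_succ {n : ℕ} {E : Type*} [NormedAddCommGroup E] [NormedSpace ℝ E]
    (μ : Fin (n + 1) → Measure ℝ) [∀ k, SigmaFinite (μ k)] (F : (Fin (n + 1) → ℝ) → E) :
    ∫ ξ, F ξ ∂(Measure.pi μ)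
      = ∫ p, F (Fin.cons p.1 p.2) ∂((μ 0).prod (Measure.pi fun k => μ k.succ)) := by
  rw [← (measurePreserving_piFinSuccAbove μ 0).symm.integral_comp']
  simp only [MeasurableEquiv.piFinSuccAbove_symm_apply, Fin.insertNthEquiv, Equiv.coe_fn_mk,
    Fin.insertNth_zero', Fin.zero_succAbove]

lemma integrable_sum_mul_pi {n : ℕ} {μ : Fin n → Measure ℝ} [∀ k, IsProbabilityMeasure (μ k)]
    (hμ : ∀ k, Integrable (fun x => x) (μ k)) (a : Fin n → ℝ) :
    Integrable (fun ξ : Fin n → ℝ => ∑ k, a k * ξ k) (Measure.pi μ) :=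
  integrable_finsetSum _ fun k _ => (integrable_comp_eval (f := fun x => x) (hμ k)).const_mul (a k)

lemma abs_integral_prod_sub_integral_prod_le {Ω Ω' : Type*} [MeasurableSpace Ω]
    [MeasurableSpace Ω'] {P : Measure Ω} [IsProbabilityMeasure P] {μ ν : Measure Ω'} [SFinite μ]
    [SFinite ν] {F : Ω × Ω' → ℝ} {C : ℝ} (hμ : Integrable F (P.prod μ))
    (hν : Integrable F (P.prod ν))
    (hC : ∀ ω, |∫ y, F (ω, y) ∂μ - ∫ y, F (ω, y) ∂ν| ≤ C) :
    |∫ p, F p ∂(P.prod μ) - ∫ p, F p ∂(P.prod ν)| ≤ C := by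
  rw [integral_prod _ hμ, integral_prod _ hν,
    ← integral_sub hμ.integral_prod_left hν.integral_prod_left, ← Real.norm_eq_abs]
  exact (norm_integral_le_of_norm_le_const (ae_of_all _ hC)).trans_eq (by simp)

section Replacement

variable {f : ℝ → ℝ} {D K r : ℝ≥0} {M N : ℝ}

lemma integrable_comp_mul_add_prod {Ω : Type*} [MeasurableSpace Ω] {θ : Measure Ω}
    [IsProbabilityMeasure θ] {μ : Measure ℝ} (hμ : IsStandardized r M μ)
    (hK : LipschitzWith K f) {X : Ω → ℝ} (hX : Integrable X θ) (a : ℝ) :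
    Integrable (fun p : ℝ × Ω => f (a * p.1 + X p.2)) (μ.prod θ) := by
  have := hμ.isProbabilityMeasure
  exact integrable_comp_of_lipschitzWith hK
    (((hμ.integrable.comp_fst θ).const_mul a).add (hX.comp_snd μ))

lemma abs_integral_prod_sub_integral_prod_le_of_isStandardized {Ω : Type*} [MeasurableSpace Ω]
    {θ : Measure Ω} [IsProbabilityMeasure θ] {μ ν : Measure ℝ} (hf : ContDiff ℝ 2 f)
    (hK : LipschitzWith K f) (hD : HolderWith D r (iteratedDeriv 2 f))
    (hμ : IsStandardized r M μ) (hν : IsStandardized r N ν) {X : Ω → ℝ} (hX : Integrable X θ)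
    (a : ℝ) :
    |∫ p, f (a * p.1 + X p.2) ∂(μ.prod θ) - ∫ p, f (a * p.1 + X p.2) ∂(ν.prod θ)|
      ≤ D / 2 * (M + N) * |a| ^ (2 + r : ℝ) := by
  have := hμ.isProbabilityMeasure
  have := hν.isProbabilityMeasure
  rw [← integral_prod_swap, ← integral_prod_swap (ν := θ) (μ := ν)]
  refine abs_integral_prod_sub_integral_prod_le (integrable_comp_mul_add_prod hμ hK hX a).swap
    (integrable_comp_mul_add_prod hν hK hX a).swap fun ω => ?_
  have hμω := hμ.abs_integral_sub_taylor_le hf hK hD (X ω) a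
  have hνω := hν.abs_integral_sub_taylor_le hf hK hD (X ω) a
  simp only [Prod.fst_swap, Prod.snd_swap, add_comm _ (X ω)]
  rw [abs_le] at *
  constructor <;> linarith

theorem abs_integral_pi_sub_integral_pi_le (hf : ContDiff ℝ 2 f) (hK : LipschitzWith K f)
    (hD : HolderWith D r (iteratedDeriv 2 f)) {n : ℕ} {μ ν : Fin n → Measure ℝ}
    (hμ : ∀ k, IsStandardized r M (μ k)) (hν : ∀ k, IsStandardized r N (ν k)) (a : Fin n → ℝ)
    (x : ℝ) :
    |∫ ξ, f (∑ k, a k * ξ k + x) ∂(Measure.pi μ) - ∫ ξ, f (∑ k, a k * ξ k + x) ∂(Measure.pi ν)|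
      ≤ D / 2 * (M + N) * ∑ k, |a k| ^ (2 + r : ℝ) := by
  have := fun k => (hμ k).isProbabilityMeasure
  have := fun k => (hν k).isProbabilityMeasure
  induction n generalizing x with
  | zero => simp
  | succ n ih =>
    let X (ξ : Fin n → ℝ) : ℝ := ∑ k, a k.succ * ξ k + x
    let F (p : ℝ × (Fin n → ℝ)) : ℝ := f (a 0 * p.1 + X p.2)
    let μ' := Measure.pi fun k => μ (Fin.succ k)
    let ν' := Measure.pi fun k => ν (Fin.succ k)
    have hXμ' : Integrable X μ' :=
      (integrable_sum_mul_pi (fun k => (hμ k.succ).integrable) _).add (integrable_const x)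
    have hXν' : Integrable X ν' :=
      (integrable_sum_mul_pi (fun k => (hν k.succ).integrable) _).add (integrable_const x)
    have tail_bound : |∫ p, F p ∂((μ 0).prod μ') - ∫ p, F p ∂((μ 0).prod ν')|
        ≤ D / 2 * (M + N) * ∑ k : Fin n, |a k.succ| ^ (2 + r : ℝ) := by
      refine abs_integral_prod_sub_integral_prod_le
        (integrable_comp_mul_add_prod (hμ 0) hK hXμ' _)
        (integrable_comp_mul_add_prod (hμ 0) hK hXν' _) fun t => ?_
      simp only [F, X, add_left_comm (a 0 * t)]
      exact ih (fun k => hμ k.succ) (fun k => hν k.succ) (fun k => a k.succ) (a 0 * t + x)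
        (fun k => inferInstance) (fun k => inferInstance)
    have head_bound : |∫ p, F p ∂((μ 0).prod ν') - ∫ p, F p ∂((ν 0).prod ν')|
        ≤ D / 2 * (M + N) * |a 0| ^ (2 + r : ℝ) :=
      abs_integral_prod_sub_integral_prod_le_of_isStandardized hf hK hD (hμ 0) (hν 0) hXν' _
    have split (ρ : Fin (n + 1) → Measure ℝ) [∀ k, IsProbabilityMeasure (ρ k)] :
        ∫ ξ, f (∑ k, a k * ξ k + x) ∂(Measure.pi ρ)
          = ∫ p, F p ∂((ρ 0).prod (Measure.pi fun k => ρ k.succ)) := by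
      simp only [integral_pi_fin_succ, Fin.sum_univ_succ, Fin.cons_zero, Fin.cons_succ, F, X,
        add_assoc]
    rw [split μ, split ν, Fin.sum_univ_succ, mul_add]
    linarith [abs_sub_le (∫ p, F p ∂((μ 0).prod μ')) (∫ p, F p ∂((μ 0).prod ν'))
      (∫ p, F p ∂((ν 0).prod ν'))]

end Replacement

/-! ### The first absolute moment of a weighted sum -/

lemma isStandardized_gaussianReal {r : ℝ} (hr : 0 ≤ r) :
    IsStandardized r (∫ x, |x| ^ (2 + r) ∂(gaussianReal 0 1)) (gaussianReal 0 1) where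
  isProbabilityMeasure := inferInstance
  integrable := by
    simpa using! memLp_one_iff_integrable.1 (memLp_id_gaussianReal (μ := 0) (v := 1) 1)
  mean := integral_id_gaussianReal
  integrable_sq := (memLp_id_gaussianReal (μ := 0) (v := 1) 2).integrable_sq
  sq := by
    rw [← variance_of_integral_eq_zero aemeasurable_id' integral_id_gaussianReal]
    simp
  integrable_moment := by
    have := (memLp_id_gaussianReal (μ := 0) (v := 1) (2 + r).toNNReal).integrable_norm_rpow'
    simpa [Real.coe_toNNReal (2 + r) (by positivity)] using this
  moment_le := le_rfl

lemma map_mul_gaussianReal_zero_one (c : ℝ) :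
    (gaussianReal 0 1).map (c * ·) = gaussianReal 0 (‖c‖₊ ^ 2) := by
  rw [gaussianReal_map_const_mul]
  congr 1
  · simp
  · ext; simp

lemma map_sum_mul_pi_gaussianReal {n : ℕ} (a : Fin n → ℝ) :
    (Measure.pi fun _ => gaussianReal 0 1).map (fun ξ => ∑ k, a k * ξ k)
      = gaussianReal 0 (∑ k, ‖a k‖₊ ^ 2) := by
  have hpi : (Measure.pi fun _ : Fin n => gaussianReal 0 1).map (fun ξ => ∑ k, a k * ξ k)
      = (Measure.pi fun k => gaussianReal 0 (‖a k‖₊ ^ 2)).map fun ξ => ∑ k, ξ k := by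
    simp only [← map_mul_gaussianReal_zero_one]
    rw [← Measure.pi_map_pi fun k => by fun_prop, Measure.map_map (by fun_prop) (by fun_prop)]
    rfl
  refine Measure.ext_of_charFun ?_
  ext t
  rw [hpi, charFun_map_sum_pi_eq_prod, Finset.prod_apply]
  simp only [charFun_gaussianReal, ← Complex.exp_sum]
  congr 1
  push_cast
  simp [Finset.sum_neg_distrib, Finset.sum_mul, Finset.sum_div]

/-- The first absolute moment `E|η|` of the standard Gaussian law. -/
noncomputable def gaussianAbsMoment : ℝ := ∫ x, |x| ∂(gaussianReal 0 1)

lemma integral_abs_gaussianReal (v : ℝ≥0) :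
    ∫ x, |x| ∂(gaussianReal 0 v) = √v * gaussianAbsMoment := by
  have hv : v = ‖√v‖₊ ^ 2 := by
    ext
    simp
  conv_lhs => rw [hv, ← map_mul_gaussianReal_zero_one]
  rw [integral_map (by fun_prop) (by fun_prop), gaussianAbsMoment, ← integral_const_mul]
  simp only [abs_mul, abs_of_nonneg (Real.sqrt_nonneg _)]

lemma integral_abs_sum_mul_pi_gaussianReal {n : ℕ} (a : Fin n → ℝ) :
    ∫ ξ, |∑ k, a k * ξ k| ∂(Measure.pi fun _ => gaussianReal 0 1)
      = √(∑ k, a k ^ 2) * gaussianAbsMoment := by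
  have h := integral_abs_gaussianReal (∑ k, ‖a k‖₊ ^ 2)
  rw [← map_sum_mul_pi_gaussianReal, integral_map
    (Measurable.aemeasurable (by fun_prop)) (by fun_prop)] at h
  simpa using h

lemma integral_smoothAbs_sub_integral_abs_mem_Icc {Ω : Type*} [MeasurableSpace Ω] {P : Measure Ω}
    [IsProbabilityMeasure P] {X : Ω → ℝ} (hX : Integrable X P) {s : ℝ} (hs : 0 < s) :
    ∫ ω, smoothAbs s (X ω) ∂P - ∫ ω, |X ω| ∂P ∈ Icc 0 s := by
  have hint := integrable_comp_of_lipschitzWith (lipschitzWith_smoothAbs hs) hX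
  rw [← integral_sub hint hX.abs]
  refine ⟨integral_nonneg fun ω => sub_nonneg.2 (abs_le_smoothAbs s _), ?_⟩
  calc ∫ ω, (smoothAbs s (X ω) - |X ω|) ∂P ≤ ∫ _, s ∂P :=
        integral_mono (hint.sub hX.abs) (integrable_const s) fun ω =>
          sub_le_iff_le_add'.2 (smoothAbs_le hs.le _)
    _ = s := by simp

lemma abs_integral_abs_sum_mul_pi_sub_le {s : ℝ} (hs : 0 < s) {D r : ℝ≥0}
    (hD : HolderWith D r (iteratedDeriv 2 (smoothAbs s))) {M N : ℝ} {n : ℕ}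
    {μ ν : Fin n → Measure ℝ} (hμ : ∀ k, IsStandardized r M (μ k))
    (hν : ∀ k, IsStandardized r N (ν k)) (a : Fin n → ℝ) :
    |∫ ξ, |∑ k, a k * ξ k| ∂(Measure.pi μ) - ∫ ξ, |∑ k, a k * ξ k| ∂(Measure.pi ν)|
      ≤ s + D / 2 * (M + N) * ∑ k, |a k| ^ (2 + r : ℝ) := by
  have := fun k => (hμ k).isProbabilityMeasure
  have := fun k => (hν k).isProbabilityMeasure
  have hsmooth := abs_integral_pi_sub_integral_pi_le (contDiff_smoothAbs hs)
    (lipschitzWith_smoothAbs hs) hD hμ hν a 0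
  simp only [add_zero] at hsmooth
  obtain ⟨hμ₁, hμ₂⟩ := integral_smoothAbs_sub_integral_abs_mem_Icc
    (integrable_sum_mul_pi (fun k => (hμ k).integrable) a) hs
  obtain ⟨hν₁, hν₂⟩ := integral_smoothAbs_sub_integral_abs_mem_Icc
    (integrable_sum_mul_pi (fun k => (hν k).integrable) a) hs
  rw [abs_le] at *
  constructor <;> linarith

lemma sum_abs_rpow_two_add_le {ι : Type*} {t : Finset ι} {a : ι → ℝ} {r ρ : ℝ} (hr : 0 ≤ r)
    (ha : ∀ k ∈ t, |a k| ≤ ρ) : ∑ k ∈ t, |a k| ^ (2 + r) ≤ ρ ^ r * ∑ k ∈ t, a k ^ 2 := by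
  rw [Finset.mul_sum]
  refine Finset.sum_le_sum fun k hk => ?_
  rw [Real.rpow_add_of_nonneg (abs_nonneg _) zero_le_two hr, Real.rpow_two, sq_abs, mul_comm]
  gcongr
  exact ha k hk

theorem eventually_abs_integral_abs_sum_mul_pi_sub_le {r : ℝ} (hr : 0 < r) (M K : ℝ) {τ : ℝ}
    (hτ : 0 < τ) :
    ∀ᶠ ρ in 𝓝[>] (0 : ℝ), ∀ (n : ℕ) (μ : Fin n → Measure ℝ), (∀ k, IsStandardized r M (μ k)) →
      ∀ a : Fin n → ℝ, (∀ k, |a k| ≤ ρ) → ∑ k, a k ^ 2 ≤ K →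
        |∫ ξ, |∑ k, a k * ξ k| ∂(Measure.pi μ) - √(∑ k, a k ^ 2) * gaussianAbsMoment| ≤ τ := by
  wlog hr1 : r ≤ 1 generalizing r M
  · filter_upwards [this one_pos (1 + M) le_rfl] with ρ hρ n μ hμ
    exact hρ n μ fun k => (hμ k).mono zero_le_one (le_of_not_ge hr1)
  lift r to ℝ≥0 using hr.le
  obtain ⟨D, hD⟩ := exists_holderWith_iteratedDeriv_two_smoothAbs (half_pos hτ)
  let N := ∫ x, |x| ^ (2 + r : ℝ) ∂(gaussianReal 0 1)
  have hlim : Tendsto (fun ρ : ℝ => D / 2 * |M + N| * (ρ ^ (r : ℝ) * |K|)) (𝓝[>] 0) (𝓝 0) := by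
    have hcont := (Real.continuous_rpow_const r.coe_nonneg).mul_const |K|
    have := (hcont.const_mul (D / 2 * |M + N|)).tendsto 0
    simp only [Real.zero_rpow hr.ne', zero_mul, mul_zero] at this
    exact this.mono_left nhdsWithin_le_nhds
  filter_upwards [hlim.eventually_le_const (half_pos hτ), self_mem_nhdsWithin]
    with ρ hρ hρ0 n μ hμ a ha hK
  rw [← integral_abs_sum_mul_pi_gaussianReal]
  have hρ0 : 0 < ρ := hρ0
  calc _ ≤ τ / 2 + D / 2 * (M + N) * ∑ k, |a k| ^ (2 + r : ℝ) :=
        abs_integral_abs_sum_mul_pi_sub_le (half_pos hτ) (hD r (mod_cast hr1)) hμ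
          (fun _ => isStandardized_gaussianReal r.coe_nonneg) a
    _ ≤ τ / 2 + D / 2 * |M + N| * (ρ ^ (r : ℝ) * |K|) := by
        gcongr
        · exact le_abs_self _
        · refine (sum_abs_rpow_two_add_le r.coe_nonneg fun k _ => ha k).trans ?_
          gcongr
          exact hK.trans (le_abs_self K)
    _ ≤ τ := by linarith

/-! ### Noise laws and regression functions -/

lemma integrable_noiseLaw_iff {p : ℝ → ℝ} (hp : Measurable p) (hp₀ : ∀ x, 0 ≤ p x) (f : ℝ → ℝ) :
    Integrable f (noiseLaw p) ↔ Integrable fun x => f x * p x := by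
  rw [noiseLaw, integrable_withDensity_iff_integrable_smul' hp.ennreal_ofReal (by simp)]
  simp only [ENNReal.toReal_ofReal (hp₀ _), smul_eq_mul, mul_comm]

lemma integral_noiseLaw {p : ℝ → ℝ} (hp : Measurable p) (hp₀ : ∀ x, 0 ≤ p x) (f : ℝ → ℝ) :
    ∫ x, f x ∂(noiseLaw p) = ∫ x, f x * p x := by
  rw [noiseLaw, integral_withDensity_eq_integral_toReal_smul hp.ennreal_ofReal (by simp)]
  simp only [ENNReal.toReal_ofReal (hp₀ _), smul_eq_mul, mul_comm]

lemma IsNoiseDensity.isStandardized {ε L : ℝ} {p : ℝ → ℝ} (h : IsNoiseDensity ε L p) :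
    IsStandardized ε L (noiseLaw p) := by
  have integrable_iff := integrable_noiseLaw_iff h.measurable h.nonneg
  have integral_eq := integral_noiseLaw h.measurable h.nonneg
  refine ⟨⟨?_⟩, (integrable_iff _).2 h.integrable_mean, (integral_eq _).trans h.mean_eq_zero,
    (integrable_iff _).2 h.integrable_sq, (integral_eq _).trans h.sq_eq_one,
    (integrable_iff _).2 h.integrable_moment, (integral_eq _).trans_le h.moment_le⟩
  rw [noiseLaw, withDensity_apply _ MeasurableSet.univ, Measure.restrict_univ,
    ← ofReal_integral_eq_lintegral_ofReal h.integrable (ae_of_all _ h.nonneg), h.integral_eq_one,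
    ENNReal.ofReal_one]

lemma extend_eq_value (S : C1) (x : unitInterval) : extend S x = value S x :=
  Set.IccExtend_of_mem _ _ x.2

lemma lipschitzWith_extend {S : C1} {C : ℝ≥0} (hS : ∀ x, |slope S x| ≤ C) :
    LipschitzWith C (extend S) := by
  have lipschitzOnWith : LipschitzOnWith C (extend S) (Icc 0 1) :=
    (convex_Icc 0 1).lipschitzOnWith_of_nnnorm_derivWithin_le
      (S.2.differentiableOn one_ne_zero) fun x hx => hS ⟨x, hx⟩
  have extend_eq_comp : extend S = (Icc 0 1).domRestrict (extend S) ∘ projIcc 0 1 zero_le_one :=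
    funext fun x => (extend_eq_value S (projIcc 0 1 zero_le_one x)).symm
  rw [extend_eq_comp, ← mul_one C]
  exact lipschitzOnWith.to_restrict.comp (LipschitzWith.projIcc zero_le_one)

@[simp]
lemma extend_zero : extend 0 = 0 := rfl

@[simp]
lemma value_zero (x : unitInterval) : value 0 x = 0 := rfl

@[simp]
lemma slope_zero (x : unitInterval) : slope 0 x = 0 := by
  simp only [slope, extend_zero]
  exact congrFun (derivWithin_const _ 0) _

lemma zero_mem_weakHolder (β : ℝ) (z₀ : unitInterval) {δ : ℝ} (hδ : 0 < δ) :
    (0 : C1) ∈ weakHolder β z₀ δ := by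
  refine ⟨mem_iUnion₂_of_mem one_pos (mem_iUnion₂_of_mem one_pos ⟨fun x => ?_, fun x y => ?_⟩),
    fun x => ?_, fun h hh _ _ => ?_⟩
  · simp
  · simpa using Real.rpow_nonneg (abs_nonneg _) _
  · simpa using hδ.le
  · simpa using mul_nonneg hδ.le (Real.rpow_nonneg hh.le _)

/-! ### Riemann sums over a window -/

lemma sum_indicator_design {n : ℕ} (hn : 0 < n) {a b : ℝ} (hb : b ≤ 1) (F : ℝ → ℝ) :
    ∑ k, (Icc a b).indicator F (design n k)
      = ∑ j ∈ Finset.Ico (⌈n * a⌉₊ - 1) ⌊n * b⌋₊, F ((j + 1) / n) := by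
  have hn' : (0 : ℝ) < n := Nat.cast_pos.2 hn
  have mem_window_iff (j : ℕ) :
      ((j : ℝ) + 1) / n ∈ Icc a b ↔ j ∈ Finset.Ico (⌈n * a⌉₊ - 1) ⌊n * b⌋₊ := by
    rw [mem_Icc, Finset.mem_Ico, Nat.sub_le_iff_le_add, Nat.ceil_le, ← Nat.succ_le_iff,
      Nat.le_floor_iff' j.succ_ne_zero, le_div_iff₀ hn', div_le_iff₀ hn', mul_comm a, mul_comm b,
      Nat.cast_succ]
  have floor_le : ⌊n * b⌋₊ ≤ n := Nat.floor_le_of_le (mul_le_of_le_one_right hn'.le hb)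
  calc ∑ k, (Icc a b).indicator F (design n k)
      = ∑ j ∈ Finset.range n, (Icc a b).indicator F ((j + 1) / n) :=
        Fin.sum_univ_eq_sum_range (fun j => (Icc a b).indicator F ((j + 1) / n)) n
    _ = ∑ j ∈ Finset.range n with j ∈ Finset.Ico (⌈n * a⌉₊ - 1) ⌊n * b⌋₊, F ((j + 1) / n) := by
        simp only [Finset.sum_filter, indicator_apply, mem_window_iff]
    _ = _ := by
        congr 1
        ext j
        simp only [Finset.mem_filter, Finset.mem_range, Finset.mem_Ico]
        omega

lemma ceil_sub_one_div_mem_Icc {n : ℕ} (hn : 0 < n) {a : ℝ} (ha : 0 < a) :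
    ((⌈n * a⌉₊ - 1 : ℕ) / n : ℝ) ∈ Icc (a - 1 / n) a := by
  have hn' : (0 : ℝ) < n := Nat.cast_pos.2 hn
  rw [Nat.cast_pred (Nat.ceil_pos.2 (mul_pos hn' ha)), mem_Icc, sub_le_iff_le_add, ← add_div,
    le_div_iff₀' hn', div_le_iff₀' hn', sub_add_cancel, sub_le_iff_le_add]
  exact ⟨Nat.le_ceil _, (Nat.ceil_lt_add_one (mul_pos hn' ha).le).le⟩

lemma floor_div_mem_Icc {n : ℕ} (hn : 0 < n) {b : ℝ} (hb : 0 ≤ b) :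
    (⌊n * b⌋₊ / n : ℝ) ∈ Icc (b - 1 / n) b := by
  have hn' : (0 : ℝ) < n := Nat.cast_pos.2 hn
  rw [mem_Icc, sub_le_iff_le_add, ← add_div, le_div_iff₀' hn', div_le_iff₀' hn']
  exact ⟨(Nat.lt_floor_add_one _).le, Nat.floor_le (mul_nonneg hn'.le hb)⟩

lemma abs_mul_integral_le_of_sub_le {F : ℝ → ℝ} {N M x y : ℝ} (hN : 0 < N) (hxy : x ≤ y)
    (hyx : y - 1 / N ≤ x) (hM : ∀ t ∈ Icc x y, |F t| ≤ M) : |N * ∫ t in x..y, F t| ≤ M := by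
  have hM₀ : 0 ≤ M := (abs_nonneg _).trans (hM x (left_mem_Icc.2 hxy))
  have h := intervalIntegral.norm_integral_le_of_norm_le_const (f := F) (C := M) fun t ht =>
    hM t (Ioc_subset_Icc_self (uIoc_of_le hxy ▸ ht))
  rw [abs_of_nonneg (sub_nonneg.2 hxy), Real.norm_eq_abs] at h
  calc _ = N * |∫ t in x..y, F t| := by rw [abs_mul, abs_of_pos hN]
    _ ≤ N * (M * (1 / N)) := by
      gcongr
      exact h.trans (by gcongr; linarith)
    _ = M := by field_simp

section RiemannSum

variable {F : ℝ → ℝ} {C : ℝ≥0}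

lemma abs_mul_sub_integral_le (hF : LipschitzWith C F) {a b : ℝ} (hab : a ≤ b) :
    |(b - a) * F b - ∫ x in a..b, F x| ≤ C * (b - a) ^ 2 := by
  have integral_sub : ∫ x in a..b, (F b - F x) = (b - a) * F b - ∫ x in a..b, F x := by
    rw [intervalIntegral.integral_sub (by simp) (hF.continuous.intervalIntegrable a b),
      intervalIntegral.integral_const, smul_eq_mul]
  rw [← integral_sub, ← Real.norm_eq_abs]
  refine (intervalIntegral.norm_integral_le_of_norm_le_const (C := C * (b - a))
    fun x hx => ?_).trans_eq ?_
  · rw [uIoc_of_le hab] at hx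
    refine (hF.norm_sub_le b x).trans ?_
    rw [Real.norm_eq_abs, abs_of_nonneg (sub_nonneg.2 hx.2)]
    gcongr
    exact hx.1.le
  · rw [abs_of_nonneg (sub_nonneg.2 hab)]
    ring

lemma abs_sum_Ico_sub_integral_le (hF : LipschitzWith C F) {n A B : ℕ} (hn : 0 < n)
    (hAB : A ≤ B) :
    |∑ j ∈ Finset.Ico A B, F ((j + 1) / n) - n * ∫ x in (A / n : ℝ)..(B / n), F x|
      ≤ C * (B / n - A / n) := by
  have hn' : (0 : ℝ) < n := Nat.cast_pos.2 hn
  have cell (j : ℕ) : |F ((j + 1) / n) - n * ∫ x in (j / n : ℝ)..((j + 1 : ℕ) / n), F x|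
      ≤ C / n := by
    have hle : (j / n : ℝ) ≤ (j + 1) / n := by gcongr; linarith
    have h := abs_mul_sub_integral_le hF hle
    rw [← sub_div, add_sub_cancel_left] at h
    rw [Nat.cast_succ]
    calc _ = n * |1 / n * F ((j + 1) / n) - ∫ x in (j / n : ℝ)..((j + 1) / n), F x| := by
          rw [← abs_of_pos hn', ← abs_mul, abs_of_pos hn', mul_sub, ← mul_assoc,
            mul_one_div_cancel hn'.ne', one_mul]
      _ ≤ n * (C * (1 / n) ^ 2) := by gcongr
      _ = C / n := by field_simp
  rw [← intervalIntegral.sum_integral_adjacent_intervals_Ico (a := fun j : ℕ => (j / n : ℝ)) hAB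
    fun _ _ => hF.continuous.intervalIntegrable _ _, Finset.mul_sum, ← Finset.sum_sub_distrib]
  calc _ ≤ ∑ _j ∈ Finset.Ico A B, (C / n : ℝ) :=
        (Finset.abs_sum_le_sum_abs _ _).trans (Finset.sum_le_sum fun j _ => cell j)
    _ = C * (B / n - A / n) := by
        rw [Finset.sum_const, Nat.card_Ico, nsmul_eq_mul, Nat.cast_sub hAB]
        ring

lemma abs_sum_indicator_design_sub_integral_le (hF : LipschitzWith C F) {n : ℕ} (hn : 0 < n)
    {a b M : ℝ} (ha : 0 < a) (hab : a ≤ b) (hb : b ≤ 1)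
    (hM : ∀ x ∈ Icc (a - 1 / n) b, |F x| ≤ M) :
    |∑ k, (Icc a b).indicator F (design n k) - n * ∫ x in a..b, F x|
      ≤ C * (b - a + 1 / n) + 2 * M := by
  have hn' : (0 : ℝ) < n := Nat.cast_pos.2 hn
  have hint (x y : ℝ) : IntervalIntegrable F volume x y := hF.continuous.intervalIntegrable x y
  have hA := ceil_sub_one_div_mem_Icc hn ha
  have hB := floor_div_mem_Icc hn (ha.le.trans hab)
  have hAB : ⌈n * a⌉₊ - 1 ≤ ⌊n * b⌋₊ :=
    Nat.le_floor (((div_le_iff₀' hn').1 hA.2).trans (by gcongr))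
  rw [sum_indicator_design hn hb]
  generalize ⌈n * a⌉₊ - 1 = A, ⌊n * b⌋₊ = B at *
  have left : |n * ∫ x in (A / n : ℝ)..a, F x| ≤ M :=
    abs_mul_integral_le_of_sub_le hn' hA.2 hA.1 fun t ht =>
      hM t ⟨hA.1.trans ht.1, ht.2.trans hab⟩
  have right : |n * ∫ x in (B / n : ℝ)..b, F x| ≤ M :=
    abs_mul_integral_le_of_sub_le hn' hB.2 hB.1 fun t ht =>
      hM t ⟨by linarith [hB.1, ht.1], ht.2⟩
  have middle : |∑ j ∈ Finset.Ico A B, F ((j + 1) / n) - n * ∫ x in (A / n : ℝ)..(B / n), F x|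
      ≤ C * (b - a + 1 / n) :=
    (abs_sum_Ico_sub_integral_le hF hn hAB).trans (by gcongr; linarith [hA.1, hB.2])
  have split : ∫ x in a..b, F x = (∫ x in (A / n : ℝ)..(B / n), F x)
      + (∫ x in (B / n : ℝ)..b, F x) - ∫ x in (A / n : ℝ)..a, F x := by
    rw [intervalIntegral.integral_add_adjacent_intervals (hint _ _) (hint _ _),
      intervalIntegral.integral_interval_sub_left (hint _ _) (hint _ _)]
  rw [split, mul_sub, mul_add]
  rw [abs_le] at middle left right ⊢
  constructor <;> linarith

end RiemannSum

/-! ### Bandwidth, rate and kernel weights -/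

section Normalizations

variable {β : ℝ} {z₀ : unitInterval} {n : ℕ}

lemma bandwidth_pos (β : ℝ) (hn : 0 < n) : 0 < bandwidth β n :=
  Real.rpow_pos_of_pos (Nat.cast_pos.2 hn) _

lemma rate_pos (β : ℝ) (hn : 0 < n) : 0 < rate β n :=
  Real.rpow_pos_of_pos (Nat.cast_pos.2 hn) _

lemma rate_sq (hβ : 0 < β) (hn : 0 < n) : rate β n ^ 2 = n * bandwidth β n := by
  have hn' : (0 : ℝ) < n := Nat.cast_pos.2 hn
  calc rate β n ^ 2 = (n : ℝ) ^ (1 + -1 / (2 * β + 1)) := by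
        rw [rate, ← Real.rpow_mul_natCast hn'.le]
        congr 1
        have : 2 * β + 1 ≠ 0 := by positivity
        field_simp
        push_cast
        ring
    _ = n * bandwidth β n := by rw [bandwidth, Real.rpow_add hn', Real.rpow_one]

lemma rate_mul_bandwidth_rpow (β : ℝ) (hn : 0 < n) : rate β n * bandwidth β n ^ β = 1 := by
  have hn' : (0 : ℝ) < n := Nat.cast_pos.2 hn
  rw [rate, bandwidth, ← Real.rpow_mul hn'.le, ← Real.rpow_add hn', div_mul_eq_mul_div,
    neg_one_mul, ← add_div, add_neg_cancel, zero_div, Real.rpow_zero]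

lemma tendsto_rate_atTop (hβ : 0 < β) : Tendsto (rate β) atTop atTop :=
  (tendsto_rpow_atTop (by positivity)).comp tendsto_natCast_atTop_atTop

lemma tendsto_bandwidth (hβ : 0 < β) : Tendsto (bandwidth β) atTop (𝓝 0) := by
  unfold bandwidth
  simp only [neg_div]
  exact (tendsto_rpow_neg_atTop (by positivity)).comp tendsto_natCast_atTop_atTop

/-- The sample size `n` is so large that the kernel window lies inside `(0, 1]` and is long enough
to contain a design point. -/
structure IsLargeSample (β : ℝ) (z₀ : unitInterval) (n : ℕ) : Prop where
  bandwidth_lt : bandwidth β n < z₀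
  add_bandwidth_le : z₀ + bandwidth β n ≤ 1
  two_le : 2 ≤ n * bandwidth β n

lemma eventually_isLargeSample (hβ : 0 < β) (hz₀ : 0 < z₀) (hz₁ : z₀ < 1) :
    ∀ᶠ n in atTop, IsLargeSample β z₀ n := by
  have rate_sq_atTop := (tendsto_pow_atTop two_ne_zero).comp (tendsto_rate_atTop hβ)
  filter_upwards [eventually_gt_atTop 0, rate_sq_atTop.eventually_ge_atTop 2,
    (tendsto_bandwidth hβ).eventually_lt_const (show (0 : ℝ) < z₀ from hz₀),
    (tendsto_bandwidth hβ).eventually_lt_const (show (0 : ℝ) < 1 - z₀ from sub_pos.2 hz₁)]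
    with n hn two_le bandwidth_lt lt_one_sub
  exact ⟨bandwidth_lt, by linarith, rate_sq hβ hn ▸ two_le⟩

lemma weight_nonneg (β : ℝ) (z₀ : unitInterval) (n : ℕ) (k : Fin n) : 0 ≤ weight β z₀ n k :=
  indicator_nonneg (fun _ _ => zero_le_one) _

lemma weight_le_one (β : ℝ) (z₀ : unitInterval) (n : ℕ) (k : Fin n) : weight β z₀ n k ≤ 1 :=
  indicator_le' (fun _ _ => le_rfl) (fun _ _ => zero_le_one) _

lemma weight_sq (β : ℝ) (z₀ : unitInterval) (n : ℕ) (k : Fin n) :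
    weight β z₀ n k ^ 2 = weight β z₀ n k := by
  rw [weight, kernel, indicator_apply]
  split_ifs <;> simp

lemma weight_mul_eq_indicator (β : ℝ) (z₀ : unitInterval) (k : Fin n) (F : ℝ → ℝ) :
    weight β z₀ n k * F (design n k)
      = (Icc (z₀ - bandwidth β n) (z₀ + bandwidth β n)).indicator F (design n k) := by
  have hh := bandwidth_pos β k.pos
  have mem_iff : ((design n k : ℝ) - z₀) / bandwidth β n ∈ Icc (-1) 1
      ↔ (design n k : ℝ) ∈ Icc (z₀ - bandwidth β n) (z₀ + bandwidth β n) := by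
    rw [mem_Icc, ← abs_le, abs_div, abs_of_pos hh, div_le_one hh, abs_sub_le_iff, mem_Icc]
    constructor <;> rintro ⟨_, _⟩ <;> constructor <;> linarith
  simp only [weight, kernel, indicator_apply, mem_iff, ite_mul, one_mul, zero_mul]

namespace IsLargeSample

lemma pos (h : IsLargeSample β z₀ n) : 0 < n := by
  rcases n.eq_zero_or_pos with rfl | hn
  · exact absurd h.two_le (by simp)
  · exact hn

lemma one_div_le (h : IsLargeSample β z₀ n) : 1 / n ≤ bandwidth β n / 2 := by
  rw [div_le_iff₀ (Nat.cast_pos.2 h.pos)]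
  linarith [h.two_le]

lemma abs_sum_weight_mul_sub_integral_le (h : IsLargeSample β z₀ n) {F : ℝ → ℝ} {C : ℝ≥0}
    (hF : LipschitzWith C F) {M : ℝ}
    (hM : ∀ x, |x - (z₀ : ℝ)| ≤ 2 * bandwidth β n → |F x| ≤ M) :
    |∑ k, weight β z₀ n k * F (design n k)
      - n * ∫ x in (z₀ - bandwidth β n : ℝ)..(z₀ + bandwidth β n), F x|
      ≤ 3 * C * bandwidth β n + 2 * M := by
  have hh := bandwidth_pos β h.pos
  simp only [weight_mul_eq_indicator]
  calc _ ≤ _ := abs_sum_indicator_design_sub_integral_le hF h.pos (sub_pos.2 h.bandwidth_lt)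
        (by linarith) h.add_bandwidth_le fun x hx => hM x (abs_le.2 ?_)
    _ ≤ C * (3 * bandwidth β n) + 2 * M := by
      gcongr
      linarith [h.one_div_le]
    _ = _ := by ring
  constructor <;> linarith [hx.1, hx.2, h.one_div_le]

lemma abs_totalWeight_sub_le (h : IsLargeSample β z₀ n) :
    |totalWeight β z₀ n - 2 * (n * bandwidth β n)| ≤ 2 := by
  have := h.abs_sum_weight_mul_sub_integral_le (LipschitzWith.const (1 : ℝ)) (M := 1) (by simp)
  simp only [mul_one, intervalIntegral.integral_const, smul_eq_mul, NNReal.coe_zero, mul_zero,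
    zero_mul, zero_add] at this
  rwa [add_sub_sub_cancel, ← two_mul, mul_left_comm] at this

lemma totalWeight_pos (h : IsLargeSample β z₀ n) : 0 < totalWeight β z₀ n := by
  linarith [(abs_le.1 h.abs_totalWeight_sub_le).1, h.two_le]

end IsLargeSample

lemma tendsto_rate_sq_div_totalWeight (hβ : 0 < β) (hz₀ : 0 < z₀) (hz₁ : z₀ < 1) :
    Tendsto (fun n => rate β n ^ 2 / totalWeight β z₀ n) atTop (𝓝 (1 / 2)) := by
  have inv_rate_sq : Tendsto (fun n => 2 * (rate β n ^ 2)⁻¹) atTop (𝓝 0) := by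
    simpa using ((tendsto_pow_atTop two_ne_zero).comp
      (tendsto_rate_atTop hβ)).inv_tendsto_atTop.const_mul 2
  have inv_ratio : Tendsto (fun n => totalWeight β z₀ n / rate β n ^ 2) atTop (𝓝 2) := by
    refine tendsto_of_tendsto_of_dist tendsto_const_nhds ?_
    refine squeeze_zero' (Eventually.of_forall fun n => dist_nonneg) ?_ inv_rate_sq
    filter_upwards [eventually_isLargeSample hβ hz₀ hz₁] with n hlarge
    have rate_sq_pos := pow_pos (rate_pos β hlarge.pos) 2
    rw [Real.dist_eq, abs_sub_comm, div_sub' rate_sq_pos.ne', abs_div, abs_of_pos rate_sq_pos,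
      div_eq_mul_inv, mul_comm (rate β n ^ 2) 2]
    gcongr
    exact rate_sq hβ hlarge.pos ▸ hlarge.abs_totalWeight_sub_le
  simpa using inv_ratio.inv₀ two_ne_zero

lemma tendsto_rate_div_totalWeight (hβ : 0 < β) (hz₀ : 0 < z₀) (hz₁ : z₀ < 1) :
    Tendsto (fun n => rate β n / totalWeight β z₀ n) atTop (𝓝 0) := by
  have := (tendsto_rate_sq_div_totalWeight hβ hz₀ hz₁).mul
    (tendsto_rate_atTop hβ).inv_tendsto_atTop
  rw [mul_zero] at this
  refine this.congr' ?_
  filter_upwards [eventually_gt_atTop 0] with n hn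
  have := (rate_pos β hn).ne'
  rw [Pi.inv_apply]
  field_simp

end Normalizations

/-! ### The normalized error of the kernel estimator -/

/-- The bias of the kernel estimator of `S(z₀)`, multiplied by `φ_n / g(z₀, S)`. -/
noncomputable def normalizedBias (β : ℝ) (z₀ : unitInterval) (g : unitInterval → C1 → ℝ) (n : ℕ)
    (S : C1) : ℝ :=
  rate β n / totalWeight β z₀ n / g z₀ S *
    ∑ k, weight β z₀ n k * (value S (design n k) - value S z₀)

/-- The coefficient of the noise variable `ξ_k` in the error of the kernel estimator of `S(z₀)`,
multiplied by `φ_n / g(z₀, S)`. -/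
noncomputable def noiseCoeff (β : ℝ) (z₀ : unitInterval) (g : unitInterval → C1 → ℝ) (n : ℕ)
    (S : C1) (k : Fin n) : ℝ :=
  rate β n / totalWeight β z₀ n * (weight β z₀ n k * g (design n k) S / g z₀ S)

/-- The root mean square of `g(·, S)` over the design points in the kernel window; it estimates
the noise level `g(z₀, S)`. -/
noncomputable def localNoiseLevel (β : ℝ) (z₀ : unitInterval) (g : unitInterval → C1 → ℝ) (n : ℕ)
    (S : C1) : ℝ :=
  √((1 / totalWeight β z₀ n) * ∑ k, weight β z₀ n k * g (design n k) S ^ 2)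

section Error

variable {β : ℝ} {z₀ : unitInterval} {g : unitInterval → C1 → ℝ} {n : ℕ} {S : C1}

lemma rate_mul_kernelEstimator_sub_div (hlarge : IsLargeSample β z₀ n) (ξ : Fin n → ℝ) :
    rate β n * ((kernelEstimator β z₀ n
        (fun k => value S (design n k) + g (design n k) S * ξ k) - value S z₀) / g z₀ S)
      = normalizedBias β z₀ g n S + ∑ k, noiseCoeff β z₀ g n S k * ξ k := by
  have hq := hlarge.totalWeight_pos.ne'
  have centre : ∑ k, weight β z₀ n k * (value S (design n k) - value S z₀)
      = ∑ k, weight β z₀ n k * value S (design n k) - totalWeight β z₀ n * value S z₀ := by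
    simp only [mul_sub, Finset.sum_sub_distrib, totalWeight, Finset.sum_mul]
  have noise : ∑ k, noiseCoeff β z₀ g n S k * ξ k = rate β n / totalWeight β z₀ n / g z₀ S *
      ∑ k, weight β z₀ n k * (g (design n k) S * ξ k) := by
    rw [Finset.mul_sum]
    refine Finset.sum_congr rfl fun k _ => ?_
    rw [noiseCoeff]
    ring
  rw [normalizedBias, centre, noise, kernelEstimator]
  simp only [mul_add, Finset.sum_add_distrib]
  field_simp
  ring

lemma lintegral_obsLaw_kernelEstimator (hlarge : IsLargeSample β z₀ n) (hg : 0 < g z₀ S)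
    {p : ℝ → ℝ} [IsProbabilityMeasure (noiseLaw p)] (hp : Integrable (fun x => x) (noiseLaw p)) :
    ∫⁻ y, ENNReal.ofReal (rate β n * (|kernelEstimator β z₀ n y - value S z₀| / g z₀ S))
        ∂(obsLaw g p S n)
      = ENNReal.ofReal (∫ ξ, |normalizedBias β z₀ g n S + ∑ k, noiseCoeff β z₀ g n S k * ξ k|
          ∂(Measure.pi fun _ => noiseLaw p)) := by
  have abs_error (x : ℝ) : rate β n * (|x| / g z₀ S) = |rate β n * (x / g z₀ S)| := by
    rw [abs_mul, abs_div, abs_of_pos hg, abs_of_pos (rate_pos β hlarge.pos)]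
  have integrable : Integrable (fun ξ => normalizedBias β z₀ g n S +
      ∑ k, noiseCoeff β z₀ g n S k * ξ k) (Measure.pi fun _ => noiseLaw p) :=
    (integrable_const _).add (integrable_sum_mul_pi (fun _ => hp) _)
  rw [obsLaw, lintegral_map (by unfold kernelEstimator; fun_prop) (by fun_prop)]
  simp only [abs_error, rate_mul_kernelEstimator_sub_div hlarge]
  exact (ofReal_integral_eq_lintegral_ofReal integrable.abs
    (ae_of_all _ fun _ => abs_nonneg _)).symm

lemma normalizedBias_zero (β : ℝ) (z₀ : unitInterval) (g : unitInterval → C1 → ℝ) (n : ℕ) :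
    normalizedBias β z₀ g n 0 = 0 := by
  simp [normalizedBias]

lemma abs_integral_window_le {δ h : ℝ} (hS : S ∈ weakHolder β z₀ δ) (hh : 0 < h)
    (h_le : h ≤ z₀) (add_le : z₀ + h ≤ 1) :
    |∫ x in (z₀ - h : ℝ)..(z₀ + h), (extend S x - value S z₀)| ≤ h * (δ * h ^ β) := by
  have rescale : ∫ x in (z₀ - h : ℝ)..(z₀ + h), (extend S x - value S z₀)
      = h * ∫ u in (-1 : ℝ)..1, (extend S (z₀ + h * u) - value S z₀) := by
    simpa [sub_eq_add_neg] using (intervalIntegral.mul_integral_comp_add_mul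
      (f := fun x => extend S x - value S z₀) (a := -1) (b := 1) h (z₀ : ℝ)).symm
  rw [rescale, abs_mul, abs_of_pos hh]
  gcongr
  exact hS.2.2 h hh (sub_nonneg.2 h_le) add_le

lemma abs_sum_weight_mul_value_sub_le (hlarge : IsLargeSample β z₀ n) {δ : ℝ}
    (hS : S ∈ weakHolder β z₀ δ) :
    |∑ k, weight β z₀ n k * (value S (design n k) - value S z₀)|
      ≤ 7 * δ⁻¹ * bandwidth β n + n * (bandwidth β n * (δ * bandwidth β n ^ β)) := by
  have hh := bandwidth_pos β hlarge.pos
  obtain ⟨C, hC⟩ : ∃ C : ℝ≥0, (C : ℝ) = δ⁻¹ := CanLift.prf _ ((abs_nonneg _).trans (hS.2.1 0))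
  have lipschitz : LipschitzWith C fun x => extend S x - value S z₀ :=
    LipschitzWith.of_dist_le_mul fun x y => by
      simpa using (lipschitzWith_extend (hC ▸ hS.2.1)).dist_le_mul x y
  have bound (x : ℝ) (hx : |x - z₀| ≤ 2 * bandwidth β n) :
      |extend S x - value S z₀| ≤ C * (2 * bandwidth β n) := by
    have := lipschitz.norm_sub_le x z₀
    rw [extend_eq_value, sub_self, sub_zero] at this
    exact this.trans (by gcongr; exact hx)
  have riemann := hlarge.abs_sum_weight_mul_sub_integral_le lipschitz bound
  have smooth : |n * ∫ x in (z₀ - bandwidth β n : ℝ)..(z₀ + bandwidth β n),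
      (extend S x - value S z₀)| ≤ n * (bandwidth β n * (δ * bandwidth β n ^ β)) := by
    rw [abs_mul, Nat.abs_cast]
    gcongr
    exact abs_integral_window_le hS hh hlarge.bandwidth_lt.le hlarge.add_bandwidth_le
  simp only [extend_eq_value] at riemann
  rw [hC] at riemann
  rw [abs_le] at riemann smooth ⊢
  constructor <;> linarith

lemma sqrt_sum_noiseCoeff_sq (hlarge : IsLargeSample β z₀ n) (hg : 0 < g z₀ S) :
    √(∑ k, noiseCoeff β z₀ g n S k ^ 2)
      = √(rate β n ^ 2 / totalWeight β z₀ n) * (localNoiseLevel β z₀ g n S / g z₀ S) := by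
  have hq := hlarge.totalWeight_pos
  have sum_eq : ∑ k, noiseCoeff β z₀ g n S k ^ 2 = rate β n ^ 2 / totalWeight β z₀ n *
      ((1 / totalWeight β z₀ n * ∑ k, weight β z₀ n k * g (design n k) S ^ 2)
        / g z₀ S ^ 2) := by
    simp only [Finset.mul_sum, Finset.sum_div]
    refine Finset.sum_congr rfl fun k _ => ?_
    rw [noiseCoeff]
    linear_combination (rate β n / totalWeight β z₀ n * g (design n k) S / g z₀ S) ^ 2 *
      weight_sq β z₀ n k
  rw [sum_eq, Real.sqrt_mul (by positivity), Real.sqrt_div' _ (sq_nonneg _), Real.sqrt_sq hg.le,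
    localNoiseLevel]

lemma abs_noiseCoeff_le (hlarge : IsLargeSample β z₀ n) {c C : ℝ} (hc : 0 < c)
    (hg : ∀ x S, c ≤ g x S ∧ g x S ≤ C) (S : C1) (k : Fin n) :
    |noiseCoeff β z₀ g n S k| ≤ rate β n / totalWeight β z₀ n * (C / c) := by
  have hq := hlarge.totalWeight_pos
  have hr := rate_pos β hlarge.pos
  have pos (x : unitInterval) : 0 < g x S := hc.trans_le (hg x S).1
  have hw := weight_nonneg β z₀ n k
  rw [noiseCoeff, abs_of_nonneg (mul_nonneg (by positivity)
    (div_nonneg (mul_nonneg hw (pos _).le) (pos _).le))]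
  gcongr
  · exact (pos z₀).le.trans (hg z₀ S).2
  · exact (mul_le_of_le_one_left (pos _).le (weight_le_one β z₀ n k)).trans (hg _ S).2
  · exact (hg z₀ S).1

end Error

/-! ### Uniform asymptotics of the error and of the risk -/

section Risk

variable {β : ℝ} {z₀ : unitInterval} {g : unitInterval → C1 → ℝ} {U : Set C1} {c C ε L δ τ : ℝ}

lemma eventually_abs_normalizedBias_le (hβ : 0 < β) (hz₀ : 0 < z₀) (hz₁ : z₀ < 1) (hc : 0 < c)
    (hg : ∀ S, c ≤ g z₀ S) (hδ : 0 < δ) (hτ : 0 < τ) :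
    ∀ᶠ n in atTop, ∀ S ∈ weakHolder β z₀ δ, |normalizedBias β z₀ g n S| ≤ δ / c + τ := by
  have riemann_error : Tendsto
      (fun n => rate β n / totalWeight β z₀ n * (7 * δ⁻¹ * bandwidth β n) / c) atTop (𝓝 0) := by
    simpa using ((tendsto_rate_div_totalWeight hβ hz₀ hz₁).mul
      ((tendsto_bandwidth hβ).const_mul (7 * δ⁻¹))).div_const c
  filter_upwards [eventually_isLargeSample hβ hz₀ hz₁, riemann_error.eventually_le_const hτ,
    (tendsto_rate_sq_div_totalWeight hβ hz₀ hz₁).eventually_le_const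
      (by norm_num : (1 / 2 : ℝ) < 1)] with n hlarge hriemann hratio S hS
  have hq := hlarge.totalWeight_pos
  have hr := rate_pos β hlarge.pos
  have hgS := hc.trans_le (hg S)
  rw [normalizedBias, abs_mul, abs_of_pos (by positivity)]
  calc _ ≤ rate β n / totalWeight β z₀ n / c * (7 * δ⁻¹ * bandwidth β n
          + n * (bandwidth β n * (δ * bandwidth β n ^ β))) := by
        gcongr
        · exact hg S
        · exact abs_sum_weight_mul_value_sub_le hlarge hS
    _ = rate β n / totalWeight β z₀ n * (7 * δ⁻¹ * bandwidth β n) / c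
          + rate β n ^ 2 / totalWeight β z₀ n * δ * (rate β n * bandwidth β n ^ β) / c := by
        rw [rate_sq hβ hlarge.pos]
        ring
    _ ≤ τ + 1 * δ * 1 / c := by
        rw [rate_mul_bandwidth_rpow β hlarge.pos]
        gcongr
    _ = δ / c + τ := by ring

lemma tendstoUniformlyOn_sqrt_sum_noiseCoeff_sq (hβ : 0 < β) (hz₀ : 0 < z₀) (hz₁ : z₀ < 1)
    (hc : 0 < c) (hg : ∀ S, c ≤ g z₀ S)
    (havg : TendstoUniformlyOn (localNoiseLevel β z₀ g) (g z₀) atTop U) :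
    TendstoUniformlyOn (fun n S => √(∑ k, noiseCoeff β z₀ g n S k ^ 2)) (fun _ => 1 / √2)
      atTop U := by
  rw [Metric.tendstoUniformlyOn_iff] at havg ⊢
  intro τ hτ
  have sqrt_ratio : Tendsto (fun n => √(rate β n ^ 2 / totalWeight β z₀ n)) atTop
      (𝓝 (1 / √2)) := by
    simpa using (tendsto_rate_sq_div_totalWeight hβ hz₀ hz₁).sqrt
  filter_upwards [havg (c * (τ / 2)) (by positivity),
    Metric.tendsto_nhds.1 sqrt_ratio (τ / 2) (by positivity),
    (tendsto_rate_sq_div_totalWeight hβ hz₀ hz₁).eventually_le_const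
      (by norm_num : (1 / 2 : ℝ) < 1),
    eventually_isLargeSample hβ hz₀ hz₁] with n hlevel hsqrt hratio hlarge S hS
  have hgS := hc.trans_le (hg S)
  have relative_level : |localNoiseLevel β z₀ g n S / g z₀ S - 1| ≤ τ / 2 := by
    rw [div_sub_one hgS.ne', abs_div, abs_of_pos hgS, div_le_iff₀' hgS, abs_sub_comm]
    exact (hlevel S hS).le.trans (by gcongr; exact hg S)
  rw [dist_comm, Real.dist_eq, sqrt_sum_noiseCoeff_sq hlarge hgS]
  rw [Real.dist_eq] at hsqrt
  calc _ = |√(rate β n ^ 2 / totalWeight β z₀ n) * (localNoiseLevel β z₀ g n S / g z₀ S - 1)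
          + (√(rate β n ^ 2 / totalWeight β z₀ n) - 1 / √2)| := by ring_nf
    _ ≤ √(rate β n ^ 2 / totalWeight β z₀ n) * |localNoiseLevel β z₀ g n S / g z₀ S - 1|
          + |√(rate β n ^ 2 / totalWeight β z₀ n) - 1 / √2| := by
        refine (abs_add_le _ _).trans_eq ?_
        rw [abs_mul, abs_of_nonneg (Real.sqrt_nonneg _)]
    _ < 1 * (τ / 2) + τ / 2 := by
        refine add_lt_add_of_le_of_lt ?_ hsqrt
        gcongr
        exact Real.sqrt_le_one.2 hratio
    _ = τ := by ring

lemma eventually_abs_noiseCoeff_le (hβ : 0 < β) (hz₀ : 0 < z₀) (hz₁ : z₀ < 1) (hc : 0 < c)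
    (hg : ∀ x S, c ≤ g x S ∧ g x S ≤ C) {ρ : ℝ} (hρ : 0 < ρ) :
    ∀ᶠ n in atTop, ∀ S k, |noiseCoeff β z₀ g n S k| ≤ ρ := by
  have bound_tendsto : Tendsto (fun n => rate β n / totalWeight β z₀ n * (C / c)) atTop (𝓝 0) := by
    simpa using (tendsto_rate_div_totalWeight hβ hz₀ hz₁).mul_const (C / c)
  filter_upwards [bound_tendsto.eventually_le_const hρ, eventually_isLargeSample hβ hz₀ hz₁]
    with n hbound hlarge S k
  exact (abs_noiseCoeff_le hlarge hc hg S k).trans hbound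

lemma eventually_abs_integral_noise_sub_le (hβ : 0 < β) (hz₀ : 0 < z₀) (hz₁ : z₀ < 1)
    (hc : 0 < c) (hg : ∀ x S, c ≤ g x S ∧ g x S ≤ C)
    (havg : TendstoUniformlyOn (localNoiseLevel β z₀ g) (g z₀) atTop U) (hε : 0 < ε) (L : ℝ)
    (hτ : 0 < τ) :
    ∀ᶠ n in atTop, ∀ S ∈ U, ∀ μ : Measure ℝ, IsStandardized ε L μ →
      |∫ ξ, |∑ k, noiseCoeff β z₀ g n S k * ξ k| ∂(Measure.pi fun _ => μ)
        - gaussianAbsMoment / √2| ≤ τ := by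
  obtain ⟨ρ, hgauss, hρ⟩ :=
    ((eventually_abs_integral_abs_sum_mul_pi_sub_le hε L 4 (half_pos hτ)).and
      self_mem_nhdsWithin).exists
  have norm_tendsto := tendstoUniformlyOn_sqrt_sum_noiseCoeff_sq hβ hz₀ hz₁ hc
    (fun S => (hg z₀ S).1) havg
  have moment_tendsto : TendstoUniformlyOn
      (fun n S => √(∑ k, noiseCoeff β z₀ g n S k ^ 2) * gaussianAbsMoment)
      (fun _ => 1 / √2 * gaussianAbsMoment) atTop U :=
    (uniformContinuous_id.mul_const' gaussianAbsMoment).comp_tendstoUniformlyOn norm_tendsto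
  filter_upwards [eventually_abs_noiseCoeff_le hβ hz₀ hz₁ hc hg hρ,
    Metric.tendstoUniformlyOn_iff.1 norm_tendsto 1 one_pos,
    Metric.tendstoUniformlyOn_iff.1 moment_tendsto (τ / 2) (half_pos hτ)]
    with n hsmall hnorm hmoment S hS μ hμ
  have sum_sq_le : ∑ k, noiseCoeff β z₀ g n S k ^ 2 ≤ 4 := by
    have inv_sqrt_two_le : 1 / √2 ≤ 1 :=
      div_le_one_of_le₀ (Real.one_le_sqrt.2 one_le_two) (Real.sqrt_nonneg 2)
    have sqrt_le : √(∑ k, noiseCoeff β z₀ g n S k ^ 2) ≤ 2 := by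
      have := hnorm S hS
      rw [dist_comm, Real.dist_eq] at this
      linarith [(abs_lt.1 this).2]
    exact (Real.sqrt_le_iff.1 sqrt_le).2.trans_eq (by norm_num)
  have hm := hmoment S hS
  rw [dist_comm, Real.dist_eq, one_div_mul_eq_div] at hm
  calc _ ≤ _ := abs_sub_le _ (√(∑ k, noiseCoeff β z₀ g n S k ^ 2) * gaussianAbsMoment) _
    _ ≤ τ / 2 + τ / 2 := add_le_add (hgauss n _ (fun _ => hμ) _ (hsmall S) sum_sq_le) hm.le
    _ = τ := add_halves τ

lemma integral_abs_const_add_le {Ω : Type*} [MeasurableSpace Ω] {P : Measure Ω}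
    [IsProbabilityMeasure P] {X : Ω → ℝ} (hX : Integrable X P) (b : ℝ) :
    ∫ ω, |b + X ω| ∂P ≤ |b| + ∫ ω, |X ω| ∂P :=
  calc _ ≤ ∫ ω, (|b| + |X ω|) ∂P :=
        integral_mono ((integrable_const b).add hX).abs ((integrable_const _).add hX.abs)
          fun _ => abs_add_le _ _
    _ = |b| + ∫ ω, |X ω| ∂P := by
        rw [integral_add (integrable_const _) hX.abs, integral_const, probReal_univ, one_smul]

lemma eventually_risk_le (hβ : 0 < β) (hz₀ : 0 < z₀) (hz₁ : z₀ < 1) (hc : 0 < c)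
    (hg : ∀ x S, c ≤ g x S ∧ g x S ≤ C)
    (havg : TendstoUniformlyOn (localNoiseLevel β z₀ g) (g z₀) atTop (weakHolder β z₀ δ))
    (hε : 0 < ε) (L : ℝ) (hδ : 0 < δ) (hτ : 0 < τ) :
    ∀ᶠ n in atTop, risk β z₀ g ε L δ n (kernelEstimator β z₀ n)
      ≤ ENNReal.ofReal (gaussianAbsMoment / √2 + δ / c + τ) := by
  filter_upwards [eventually_isLargeSample hβ hz₀ hz₁,
    eventually_abs_normalizedBias_le hβ hz₀ hz₁ hc (fun S => (hg z₀ S).1) hδ (half_pos hτ),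
    eventually_abs_integral_noise_sub_le hβ hz₀ hz₁ hc hg havg hε L (half_pos hτ)]
    with n hlarge hbias hnoise
  refine iSup₂_le fun p hp => iSup₂_le fun S hS => ?_
  have hμ := hp.isStandardized
  have := hμ.isProbabilityMeasure
  rw [lintegral_obsLaw_kernelEstimator hlarge (hc.trans_le (hg z₀ S).1) hμ.integrable]
  gcongr
  linarith [integral_abs_const_add_le (integrable_sum_mul_pi (fun _ => hμ.integrable)
    (noiseCoeff β z₀ g n S)) (normalizedBias β z₀ g n S), hbias S hS,
    (abs_le.1 (hnoise S hS _ hμ)).2]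

lemma eventually_le_risk (hβ : 0 < β) (hz₀ : 0 < z₀) (hz₁ : z₀ < 1) (hc : 0 < c)
    (hg : ∀ x S, c ≤ g x S ∧ g x S ≤ C)
    (havg : TendstoUniformlyOn (localNoiseLevel β z₀ g) (g z₀) atTop (weakHolder β z₀ δ))
    (hε : 0 < ε) {p : ℝ → ℝ} (hp : IsNoiseDensity ε L p) (hδ : 0 < δ) (hτ : 0 < τ) :
    ∀ᶠ n in atTop, ENNReal.ofReal (gaussianAbsMoment / √2 - τ)
      ≤ risk β z₀ g ε L δ n (kernelEstimator β z₀ n) := by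
  have hμ := hp.isStandardized
  have := hμ.isProbabilityMeasure
  have zero_mem := zero_mem_weakHolder β z₀ hδ
  filter_upwards [eventually_isLargeSample hβ hz₀ hz₁,
    eventually_abs_integral_noise_sub_le hβ hz₀ hz₁ hc hg havg hε L hτ] with n hlarge hnoise
  refine le_iSup₂_of_le p hp (le_iSup₂_of_le 0 zero_mem ?_)
  rw [lintegral_obsLaw_kernelEstimator hlarge (hc.trans_le (hg z₀ 0).1) hμ.integrable]
  simp only [normalizedBias_zero, zero_add]
  gcongr
  linarith [(abs_le.1 (hnoise 0 zero_mem _ hμ)).1]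

lemma limsup_limsup_risk_le (hβ : 0 < β) (hz₀ : 0 < z₀) (hz₁ : z₀ < 1) (hc : 0 < c)
    (hg : ∀ x S, c ≤ g x S ∧ g x S ≤ C)
    (havg : ∀ δ, 0 < δ → δ < 1 →
      TendstoUniformlyOn (localNoiseLevel β z₀ g) (g z₀) atTop (weakHolder β z₀ δ))
    (hε : 0 < ε) (L : ℝ) :
    limsup (fun δ => limsup (fun n => risk β z₀ g ε L δ n (kernelEstimator β z₀ n)) atTop)
      (𝓝[>] 0) ≤ sharpConstant := by
  have bound_tendsto : Tendsto (fun δ => ENNReal.ofReal (gaussianAbsMoment / √2 + δ / c + δ))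
      (𝓝[>] 0) (𝓝 sharpConstant) := by
    refine ENNReal.tendsto_ofReal (Tendsto.mono_left ?_ nhdsWithin_le_nhds)
    exact Continuous.tendsto' (by fun_prop) 0 _ (by simp [gaussianAbsMoment])
  rw [← bound_tendsto.limsup_eq]
  refine limsup_le_limsup ?_
  filter_upwards [Ioo_mem_nhdsGT one_pos] with δ ⟨hδ, hδ₁⟩
  exact limsup_le_of_le
    (h := eventually_risk_le hβ hz₀ hz₁ hc hg (havg δ hδ hδ₁) hε L hδ hδ)

lemma sharpConstant_le_liminf_risk (hβ : 0 < β) (hz₀ : 0 < z₀) (hz₁ : z₀ < 1) (hc : 0 < c)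
    (hg : ∀ x S, c ≤ g x S ∧ g x S ≤ C)
    (havg : TendstoUniformlyOn (localNoiseLevel β z₀ g) (g z₀) atTop (weakHolder β z₀ δ))
    (hε : 0 < ε) {p : ℝ → ℝ} (hp : IsNoiseDensity ε L p) (hδ : 0 < δ) :
    sharpConstant ≤ liminf (fun n => risk β z₀ g ε L δ n (kernelEstimator β z₀ n)) atTop := by
  have bound_tendsto : Tendsto (fun τ => ENNReal.ofReal (gaussianAbsMoment / √2 - τ)) (𝓝[>] 0)
      (𝓝 sharpConstant) := by
    refine ENNReal.tendsto_ofReal (Tendsto.mono_left ?_ nhdsWithin_le_nhds)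
    exact Continuous.tendsto' (by fun_prop) 0 _ (by simp [gaussianAbsMoment])
  refine le_of_tendsto bound_tendsto ?_
  filter_upwards [self_mem_nhdsWithin] with τ hτ
  exact le_liminf_of_le (h := eventually_le_risk hβ hz₀ hz₁ hc hg havg hε hp hδ hτ)

end Risk

end HeteroReg

open HeteroReg in
theorem theorem4_general (β : ℝ) (hβ : 0 < β) (z₀ : unitInterval) (hz₀ : 0 < z₀) (hz₁ : z₀ < 1)
    (g : unitInterval → C1 → ℝ) {c C : ℝ} (hc : 0 < c) (hg : ∀ x S, c ≤ g x S ∧ g x S ≤ C)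
    (havg : ∀ δ, 0 < δ → δ < 1 →
      TendstoUniformlyOn (localNoiseLevel β z₀ g) (g z₀) atTop (weakHolder β z₀ δ))
    (ε L : ℝ) (hε : 0 < ε) {p : ℝ → ℝ} (hp : IsNoiseDensity ε L p) :
    limsup (fun δ : ℝ =>
        limsup (fun n : ℕ => risk β z₀ g ε L δ n (kernelEstimator β z₀ n)) atTop)
      (𝓝[>] 0) ≤ sharpConstant ∧
    ∀ δ : ℝ, 0 < δ → δ < 1 →
      sharpConstant ≤
        liminf (fun n : ℕ => risk β z₀ g ε L δ n (kernelEstimator β z₀ n)) atTop :=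
  ⟨limsup_limsup_risk_le hβ hz₀ hz₁ hc hg havg hε L, fun δ hδ hδ₁ =>
    sharpConstant_le_liminf_risk hβ hz₀ hz₁ hc hg (havg δ hδ hδ₁) hε hp hδ⟩

theorem theorem4 (β : ℝ) (hβ₁ : 1 < β) (hβ₂ : β ≤ 2)
    (z₀ : unitInterval) (hz₀ : 0 < z₀) (hz₁ : z₀ < 1)
    (g : unitInterval → HeteroReg.C1 → ℝ) (hg : HeteroReg.IsScale β z₀ g)
    (ε L : ℝ) (hε : 0 < ε)
    (hL : HeteroReg.IsNoiseDensity ε L (gaussianPDFReal 0 1)) :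
    limsup (fun δ : ℝ =>
        limsup (fun n : ℕ =>
          HeteroReg.risk β z₀ g ε L δ n (HeteroReg.kernelEstimator β z₀ n)) atTop)
      (𝓝[>] 0) ≤ HeteroReg.sharpConstant ∧
    ∀ δ : ℝ, 0 < δ → δ < 1 →
      HeteroReg.sharpConstant ≤
        liminf (fun n : ℕ =>
          HeteroReg.risk β z₀ g ε L δ n (HeteroReg.kernelEstimator β z₀ n)) atTop := by
  obtain ⟨c, C, hc, bounds⟩ := hg.bounds
  exact theorem4_general β (one_pos.trans hβ₁) z₀ hz₀ hz₁ g hc bounds hg.average ε L hε hL
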